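/- Let $n\ge 1$ and let $a=(a_0,\dots,a_n)\in\mathbb Z^{n+1}$. For $s\ge 0$ let $D(s)\subset\mathbb R^s$ be the set of all $(y_1,\dots,y_s)$ such that for every $1\le j\le s-n$ the minimum $\min_{0\le i\le n}\{y_{j+i}+a_i\}$ is attained for at least two different values of $i$. The set $D(s)$ is a finite union of polyhedra; let $d_a(s):=\dim D(s)$ be its dimension, i.e. the largest dimension of a polyhedron contained in it (the tropical Hilbert function of $a$), and let $H(a):=\lim_{s\to\infty}d_a(s)/s$ (the tropical entropy of $a$). There are absolute constants $C_1,C_2\in\mathbb N$ such that for all integers $n\ge 1$, $M\ge 1$ and every $a\in\mathbb Z^{n+1}$ with $\max_i a_i-\min_i a_i\le M$ the following holds: the limit $H(a)$ exists, and there are a positive integer $p<\exp\big((C_2Mn)^n\big)$ and a function $r:\mathbb N\to\mathbb R$ with $r(s+p)=r(s)$ for all $s$, such that $$d_a(s)=H(a)\,s+r(s)\qquad\text{for all integers } s>(Mn)^{C_1n}.$$ -/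

import Mathlib

open Filter Topology

namespace TropicalHilbert

/-- The minimum of the finite family `f` is attained for at least two different indices. -/
def MinAttainedTwice {m : ℕ} (f : Fin m → ℝ) : Prop :=
  ∃ i₁ i₂ : Fin m, i₁ ≠ i₂ ∧ (∀ i, f i₁ ≤ f i) ∧ (∀ i, f i₂ ≤ f i)

/-- The set `D(s) ⊆ ℝ^s` of the sequences of length `s` that satisfy the vector
`a = (a_0, …, a_n)`: for every window `y_j, …, y_{j+n}` that lies inside the sequence, the
minimum of `y_{j+i} + a_i`, `0 ≤ i ≤ n`, is attained at least twice. Coordinates are numbered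
`0, …, s - 1` here. -/
def solutions {n : ℕ} (a : Fin (n + 1) → ℤ) (s : ℕ) : Set (Fin s → ℝ) :=
  {y | ∀ (j : ℕ) (hj : j + n < s),
    MinAttainedTwice (fun i : Fin (n + 1) => y ⟨j + i, by omega⟩ + (a i : ℝ))}

/-- A polyhedron in `ℝ^s`: the solution set of a finite system of linear inequalities, each of
them weak or strict. -/
def IsPolyhedron {s : ℕ} (P : Set (Fin s → ℝ)) : Prop :=
  ∃ S T : Finset ((Fin s → ℝ) × ℝ),
    P = {x | (∀ p ∈ S, p.1 ⬝ᵥ x ≤ p.2) ∧ (∀ p ∈ T, p.1 ⬝ᵥ x < p.2)}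

/-- The dimension of a finite union `X` of polyhedra: the largest dimension of a polyhedron
contained in `X`, where the dimension of a polyhedron is that of its affine hull. -/
noncomputable def polyhedralDim {s : ℕ} (X : Set (Fin s → ℝ)) : ℕ :=
  sSup {k | ∃ P : Set (Fin s → ℝ), IsPolyhedron P ∧ P ⊆ X ∧
    k = Module.finrank ℝ (vectorSpan ℝ P)}

/-- The supremum in the definition of the dimension is a maximum. -/
theorem polyhedralDim_isGreatest {s : ℕ} (X : Set (Fin s → ℝ)) :
    IsGreatest {k | ∃ P : Set (Fin s → ℝ), IsPolyhedron P ∧ P ⊆ X ∧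
      k = Module.finrank ℝ (vectorSpan ℝ P)} (polyhedralDim X) := by
  have hb : BddAbove {k | ∃ P : Set (Fin s → ℝ), IsPolyhedron P ∧ P ⊆ X ∧
      k = Module.finrank ℝ (vectorSpan ℝ P)} := by
    refine ⟨s, ?_⟩
    rintro k ⟨P, -, -, rfl⟩
    simpa using Submodule.finrank_le (vectorSpan ℝ P)
  refine ⟨Nat.sSup_mem ⟨0, ∅, ⟨∅, {(0, 0)}, ?_⟩, Set.empty_subset _, ?_⟩ hb,
    fun k hk => le_csSup hb hk⟩
  · ext x
    simp
  · rw [vectorSpan_empty, finrank_bot]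

/-- `D(s)` is a finite union of polyhedra, so that its dimension makes sense. -/
theorem solutions_eq_sUnion {n : ℕ} (a : Fin (n + 1) → ℤ) (s : ℕ) :
    ∃ F : Set (Set (Fin s → ℝ)), F.Finite ∧ (∀ P ∈ F, IsPolyhedron P) ∧
      solutions a s = ⋃₀ F := by
  classical
  let J := {j : Fin s // (j : ℕ) + n < s}
  let pos : J → Fin (n + 1) → Fin s := fun j i => ⟨j.1 + i, by have := j.2; omega⟩
  let K := {c : Fin (n + 1) × Fin (n + 1) // c.1 ≠ c.2}
  let cell : (J → K) → Set (Fin s → ℝ) := fun c => {y | ∀ j i,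
    y (pos j (c j).1.1) + (a (c j).1.1 : ℝ) ≤ y (pos j i) + (a i : ℝ) ∧
    y (pos j (c j).1.2) + (a (c j).1.2 : ℝ) ≤ y (pos j i) + (a i : ℝ)}
  refine ⟨Set.range cell, Set.finite_range _, ?_, ?_⟩
  · rintro _ ⟨c, rfl⟩
    let row : J → Fin (n + 1) → Fin (n + 1) → (Fin s → ℝ) × ℝ := fun j k i =>
      (Pi.single (pos j k) 1 - Pi.single (pos j i) 1, (a i : ℝ) - a k)
    have hrow : ∀ j k i (y : Fin s → ℝ), (row j k i).1 ⬝ᵥ y ≤ (row j k i).2 ↔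
        y (pos j k) + (a k : ℝ) ≤ y (pos j i) + (a i : ℝ) := by
      intro j k i y
      simp only [row, sub_dotProduct, single_dotProduct, one_mul]
      constructor <;> intro h <;> linarith
    refine ⟨Finset.univ.image (fun p : J × Fin (n + 1) => row p.1 (c p.1).1.1 p.2) ∪
      Finset.univ.image (fun p : J × Fin (n + 1) => row p.1 (c p.1).1.2 p.2), ∅, ?_⟩
    ext y
    constructor
    · intro hy
      refine ⟨?_, by simp⟩
      intro p hp
      rcases Finset.mem_union.1 hp with hp | hp <;>
        obtain ⟨q, -, rfl⟩ := Finset.mem_image.1 hp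
      · exact (hrow _ _ _ _).2 (hy q.1 q.2).1
      · exact (hrow _ _ _ _).2 (hy q.1 q.2).2
    · rintro ⟨hy, -⟩ j i
      exact ⟨(hrow _ _ _ _).1 (hy _ (Finset.mem_union_left _
          (Finset.mem_image_of_mem _ (Finset.mem_univ (j, i))))),
        (hrow _ _ _ _).1 (hy _ (Finset.mem_union_right _
          (Finset.mem_image_of_mem _ (Finset.mem_univ (j, i)))))⟩
  · ext y
    constructor
    · intro hy
      have hy' : ∀ j : J, ∃ k : K, ∀ i,
          y (pos j k.1.1) + (a k.1.1 : ℝ) ≤ y (pos j i) + (a i : ℝ) ∧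
          y (pos j k.1.2) + (a k.1.2 : ℝ) ≤ y (pos j i) + (a i : ℝ) := by
        intro j
        obtain ⟨i₁, i₂, hne, h₁, h₂⟩ := hy j.1 j.2
        exact ⟨⟨(i₁, i₂), hne⟩, fun i => ⟨h₁ i, h₂ i⟩⟩
      choose c hc using hy'
      exact ⟨cell c, ⟨c, rfl⟩, hc⟩
    · rintro ⟨_, ⟨c, rfl⟩, hy⟩ j hj
      let j' : J := ⟨⟨j, by omega⟩, hj⟩
      exact ⟨(c j').1.1, (c j').1.2, (c j').2, fun i => (hy j' i).1, fun i => (hy j' i).2⟩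

/-- The tropical Hilbert function `d_a(s) = dim D(s)` of the vector `a`. -/
noncomputable def tropicalHilbert {n : ℕ} (a : Fin (n + 1) → ℤ) (s : ℕ) : ℕ :=
  polyhedralDim (solutions a s)

/-- The tropical entropy `H(a) = lim d_a(s) / s` of the vector `a`. -/
noncomputable def tropicalEntropy {n : ℕ} (a : Fin (n + 1) → ℤ) : ℝ :=
  limUnder atTop (fun s : ℕ => (tropicalHilbert a s : ℝ) / (s : ℝ))

end TropicalHilbert

/-!
The dimension of `D(s)` is turned into the weight of a longest walk in a finite graph.

*Fresh entries.* Call an entry `y k` of a solution fresh if it differs by a non-integer from each of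
the `n` entries before it. The minima of a window that are tied differ by integers, and the entries
tied through a chain of windows move together in the cell of `y`; hence `d_a(s)` is the largest
number of fresh entries of a solution of length `s` (`tropicalHilbert_isGreatest`). For the upper
bound one takes a point of a polyhedron at which coordinate differences are integers only if they
are constant on the polyhedron.

*Regions.* The minima of consecutive windows differ by at most `M`, so that lowering entries by
integers makes all steps of a solution smaller than `M + 1` (`exists_smallStep_solution`). The
solution property and freshness depend only on how differences of entries of a window compare with
integers, that is on the region of the window, and a further entry can be matched in each window of
the same region (`exists_point_same_floors`). Thus solutions are walks in a graph on at most
`N = (2 * M + 3) ^ (n - 1) * n ^ n` regions, and the number of fresh entries is the weight of the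
walk (`tropicalHilbert_isGreatest_walk`).

*Walks.* In a graph with at most `N` vertices and weights in `{0, 1}`, the maximal weight `W T` of
walks of length `T` satisfies `W (T + N !) = W T + q * N !` for all `T` above a bound polynomial in
`N`, where `q` is the largest mean weight of a closed walk (`exists_walk_period`).

For `n = 1` the Hilbert function is `1`; for `n ≥ 2` the transient and `N !` are within the bounds
claimed (`transient_le`, `factorial_lt_exp`).
-/

namespace TropicalHilbert

/-! ### Walks of maximal weight in a finite weighted graph -/

/-- `Walk E T u v c`: there is a walk of length `T` from `u` to `v` of total weight `c` in the
directed multigraph whose edges of weight `b` from `u` to `v` are given by `E u v b`. -/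
def Walk {V : Type*} (E : V → V → ℕ → Prop) : ℕ → V → V → ℕ → Prop
  | 0, u, v, c => u = v ∧ c = 0
  | T + 1, u, w, c => ∃ v c' b, Walk E T u v c' ∧ E v w b ∧ c = c' + b

section Walk

variable {V : Type*} {E : V → V → ℕ → Prop}

theorem Walk.append {T T' c c' : ℕ} {u v w : V} (h : Walk E T u v c) (h' : Walk E T' v w c') :
    Walk E (T + T') u w (c + c') := by
  induction T' generalizing w c' with
  | zero =>
    obtain ⟨rfl, rfl⟩ := h'
    exact h
  | succ T' ih =>
    obtain ⟨x, d, b, hd, hb, rfl⟩ := h'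
    exact ⟨x, c + d, b, ih hd, hb, by omega⟩

theorem Walk.iterate {l c : ℕ} {x : V} (h : Walk E l x x c) (k : ℕ) :
    Walk E (k * l) x x (k * c) := by
  induction k with
  | zero => simp [Walk]
  | succ k ih => simpa only [Nat.succ_mul] using ih.append h

theorem Walk.mono {E' : V → V → ℕ → Prop} (hE : ∀ u v b, E u v b → E' u v b) {T c : ℕ} {u v : V}
    (h : Walk E T u v c) : Walk E' T u v c := by
  induction T generalizing v c with
  | zero => exact h
  | succ T ih =>
    obtain ⟨x, d, b, hd, hb, rfl⟩ := h
    exact ⟨x, d, b, ih hd, hE _ _ _ hb, rfl⟩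

theorem Walk.le_length (hb : ∀ u v b, E u v b → b ≤ 1) {T c : ℕ} {u v : V}
    (h : Walk E T u v c) : c ≤ T := by
  induction T generalizing v c with
  | zero => exact h.2.le
  | succ T ih =>
    obtain ⟨x, d, b, hd, he, rfl⟩ := h
    have := ih hd
    have := hb _ _ _ he
    omega

theorem Walk.of_seq {x : ℕ → V} {f : ℕ → ℕ} {i d : ℕ}
    (h : ∀ k, k < d → E (x (i + k)) (x (i + k + 1)) (f (i + k))) :
    Walk E d (x i) (x (i + d)) (∑ k ∈ Finset.range d, f (i + k)) := by
  induction d with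
  | zero => simp [Walk]
  | succ d ih =>
    exact ⟨_, _, _, ih fun k hk => h k (by omega), h d (by omega), Finset.sum_range_succ _ _⟩

theorem Walk.exists_seq {T c : ℕ} {u w : V} (h : Walk E T u w c) :
    ∃ (x : ℕ → V) (f : ℕ → ℕ), x 0 = u ∧ x T = w ∧ c = ∑ k ∈ Finset.range T, f k ∧
      ∀ k, k < T → E (x k) (x (k + 1)) (f k) := by
  induction T generalizing w c with
  | zero => exact ⟨fun _ => u, fun _ => 0, rfl, h.1, by simp [h.2], by simp⟩
  | succ T ih =>
    obtain ⟨v, d, b, hd, hb, rfl⟩ := h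
    obtain ⟨x, f, h0, hT, hc, hE⟩ := ih hd
    refine ⟨fun k => if k ≤ T then x k else w, fun k => if k < T then f k else b, by simp [h0],
      by simp, ?_, ?_⟩
    · rw [Finset.sum_range_succ, hc]
      congr 1
      · exact Finset.sum_congr rfl fun k hk => by simp [Finset.mem_range.1 hk]
      · simp
    · intro k hk
      rcases Nat.lt_succ_iff_lt_or_eq.1 hk with hk | rfl
      · simpa [hk, hk.le, Nat.succ_le_iff.2 hk] using hE k hk
      · simpa [hT] using hb

theorem Walk.split {a b c : ℕ} {u w : V} (h : Walk E (a + b) u w c) :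
    ∃ v c₁ c₂, Walk E a u v c₁ ∧ Walk E b v w c₂ ∧ c = c₁ + c₂ := by
  induction b generalizing w c with
  | zero => exact ⟨w, c, 0, h, ⟨rfl, rfl⟩, rfl⟩
  | succ b ih =>
    obtain ⟨x, d, e, hd, he, rfl⟩ := h
    obtain ⟨v, c₁, c₂, h₁, h₂, rfl⟩ := ih hd
    exact ⟨v, c₁, c₂ + e, h₁, ⟨x, c₂, e, h₂, he, rfl⟩, by omega⟩

/-- A walk through at most `N` vertices that is longer than `N * l` contains a closed walk whose
length is a positive multiple of `l`, at most `N * l`: two of its first `N * l + 1` vertices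
agree and have positions that are congruent modulo `l`. -/
theorem Walk.exists_closed {A : Finset V} {N : ℕ} (hA : ∀ u v b, E u v b → u ∈ A)
    (hN : A.card ≤ N) {T c l : ℕ} {u w : V} (hl : 0 < l) (h : Walk E T u w c) (hT : N * l < T) :
    ∃ y a k b c₁ c₂ c₃, 0 < k ∧ k ≤ N ∧ T = a + k * l + b ∧ c = c₁ + c₂ + c₃ ∧
      Walk E a u y c₁ ∧ Walk E (k * l) y y c₂ ∧ Walk E b y w c₃ := by
  obtain ⟨x, f, h0, hw, hc, hE⟩ := h.exists_seq
  obtain ⟨i, hi, j, hj, hij, he⟩ : ∃ i ∈ Finset.range (N * l + 1), ∃ j ∈ Finset.range (N * l + 1),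
      i ≠ j ∧ (x i, i % l) = (x j, j % l) := by
    refine Finset.exists_ne_map_eq_of_card_lt_of_maps_to (t := A ×ˢ Finset.range l) ?_ ?_
    · rw [Finset.card_product, Finset.card_range, Finset.card_range]
      exact Nat.lt_succ_of_le (Nat.mul_le_mul_right _ hN)
    · intro i hi
      have hi' := Finset.mem_range.1 (Finset.mem_coe.1 hi)
      simpa using ⟨hA _ _ _ (hE i (by omega)), Nat.mod_lt _ hl⟩
  wlog hlt : i < j generalizing i j
  · exact this j hj i hi hij.symm he.symm (by omega)
  rw [Finset.mem_range] at hi hj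
  obtain ⟨he₁, he₂⟩ := Prod.mk.inj he
  obtain ⟨k, hk⟩ : l ∣ j - i := (Nat.modEq_iff_dvd' hlt.le).1 he₂
  have hjk : j = i + k * l := by rw [mul_comm k]; omega
  obtain ⟨b, rfl⟩ : ∃ b, T = j + b := ⟨T - j, by omega⟩
  have h₁ := Walk.of_seq (E := E) (x := x) (f := f) (i := 0) (d := i)
    fun k hk => by simpa using hE k (by omega)
  have h₂ := Walk.of_seq (E := E) (x := x) (f := f) (i := i) (d := k * l)
    fun k hk => hE _ (by omega)
  have h₃ := Walk.of_seq (E := E) (x := x) (f := f) (i := j) (d := b)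
    fun k hk => hE _ (by omega)
  simp only [Nat.zero_add] at h₁
  rw [h0] at h₁
  rw [← hjk, ← he₁] at h₂
  rw [hw, ← he₁] at h₃
  refine ⟨x i, i, k, b, _, _, _, ?_, ?_, by rw [hjk], ?_, h₁, h₂, h₃⟩
  · rcases Nat.eq_zero_or_pos k with rfl | hk
    · omega
    · exact hk
  · exact Nat.le_of_mul_le_mul_right (by omega) hl
  · rw [hc, Finset.sum_range_add, hjk, Finset.sum_range_add]

/-- If every closed walk of length at most `N` has mean weight at most `q`, so has every closed
walk. -/
theorem Walk.closed_le {A : Finset V} {N : ℕ} (hA : ∀ u v b, E u v b → u ∈ A)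
    (hN : A.card ≤ N) {q : ℝ}
    (hq : ∀ l x c, 0 < l → l ≤ N → Walk E l x x c → (c : ℝ) ≤ q * l) {T c : ℕ} {x : V}
    (h : Walk E T x x c) : (c : ℝ) ≤ q * T := by
  induction T using Nat.strong_induction_on generalizing x c with
  | _ T ih =>
    rcases Nat.eq_zero_or_pos T with rfl | hT
    · simp [h.2]
    rcases le_or_gt T N with hTN | hTN
    · exact hq _ _ _ hT hTN h
    obtain ⟨y, a, k, b, c₁, c₂, c₃, hk, hkN, rfl, rfl, h₁, h₂, h₃⟩ :=
      h.exists_closed hA hN one_pos (by omega)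
    have e₁ := ih (a + b) (by omega) (h₁.append h₃)
    have e₂ := hq _ _ _ (by omega) (by omega) h₂
    push_cast at e₁ e₂ ⊢
    linarith

/-- If every closed walk of length at most `N` has mean weight at most `q`, then every walk has
weight at most `q` times its length, up to a constant. -/
theorem Walk.le_add {A : Finset V} {N : ℕ} (hA : ∀ u v b, E u v b → u ∈ A)
    (hb : ∀ u v b, E u v b → b ≤ 1) (hN : A.card ≤ N) {q : ℝ} (hq1 : -1 ≤ q * N)
    (hq : ∀ l x c, 0 < l → l ≤ N → Walk E l x x c → (c : ℝ) ≤ q * l) {T c : ℕ} {u w : V}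
    (h : Walk E T u w c) : (c : ℝ) ≤ N + 1 + q * T := by
  induction T using Nat.strong_induction_on generalizing u w c with
  | _ T ih =>
    rcases le_or_gt T N with hTN | hTN
    · have h1 : (c : ℝ) ≤ T := by exact_mod_cast h.le_length hb
      have h2 : (T : ℝ) ≤ N := by exact_mod_cast hTN
      have h3 : -1 ≤ q * T := by
        rcases le_or_gt 0 q with h0 | h0
        · have : 0 ≤ q * T := by positivity
          linarith
        · nlinarith
      linarith
    obtain ⟨y, a, k, b, c₁, c₂, c₃, hk, hkN, rfl, rfl, h₁, h₂, h₃⟩ :=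
      h.exists_closed hA hN one_pos (by omega)
    have e₁ := ih (a + b) (by omega) (h₁.append h₃)
    have e₂ := hq _ _ _ (by omega) (by omega) h₂
    push_cast at e₁ e₂ ⊢
    linarith

/-- Closed walks can be cut out of a walk until its length is at most `N * l`, without changing
the length modulo `l` and without decreasing the weight relative to the mean `q`. -/
theorem Walk.reduce {A : Finset V} {N : ℕ} (hA : ∀ u v b, E u v b → u ∈ A)
    (hN : A.card ≤ N) {q : ℝ} (hq : ∀ l x c, Walk E l x x c → (c : ℝ) ≤ q * l)
    {T c l : ℕ} {u w : V} (hl : 0 < l) (h : Walk E T u w c) :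
    ∃ T' c', Walk E T' u w c' ∧ T' ≤ N * l ∧ (∃ k, T = T' + k * l) ∧
      (c : ℝ) - q * T ≤ c' - q * T' := by
  induction T using Nat.strong_induction_on generalizing u w c with
  | _ T ih =>
    rcases le_or_gt T (N * l) with hT | hT
    · exact ⟨T, c, h, hT, ⟨0, by simp⟩, le_rfl⟩
    obtain ⟨y, a, k, b, c₁, c₂, c₃, hk, hkN, rfl, rfl, h₁, h₂, h₃⟩ :=
      h.exists_closed hA hN hl hT
    have : 0 < k * l := Nat.mul_pos hk hl
    obtain ⟨T', c', hw, hT', ⟨j, hj⟩, hc⟩ := ih (a + b) (by omega) (h₁.append h₃)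
    refine ⟨T', c', hw, hT', ⟨j + k, by rw [Nat.add_mul]; omega⟩, le_trans ?_ hc⟩
    have e₂ := hq _ _ _ h₂
    push_cast at e₂ ⊢
    linarith

theorem Walk.avoid_or_hit (Z : Set V) {T c : ℕ} {u w : V} (h : Walk E T u w c) :
    Walk (fun x y b => E x y b ∧ x ∉ Z) T u w c ∨
      ∃ x ∈ Z, ∃ a b c₁ c₂, T = a + b ∧ c = c₁ + c₂ ∧ Walk E a u x c₁ ∧ Walk E b x w c₂ := by
  induction T generalizing w c with
  | zero => exact Or.inl h
  | succ T ih =>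
    obtain ⟨v, d, e, hd, he, rfl⟩ := h
    rcases ih hd with h' | ⟨x, hx, a, b, c₁, c₂, rfl, rfl, h₁, h₂⟩
    · by_cases hv : v ∈ Z
      · exact Or.inr ⟨v, hv, T, 1, d, e, rfl, rfl, hd, v, 0, e, ⟨rfl, rfl⟩, he, by simp⟩
      · exact Or.inl ⟨v, d, e, h', ⟨he, hv⟩, rfl⟩
    · exact Or.inr ⟨x, hx, a, b + 1, c₁, c₂ + e, rfl, by omega, h₁, v, c₂, e, h₂, he, rfl⟩

/-- Maximal weights of walks are eventually linear up to a periodic term. A closed walk of length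
at most `N` is critical if its mean weight is the largest possible one, `q`. A long optimal walk
meets a critical closed walk of some length `l ∣ N !`, as means below `q` are smaller by at
least `1 / N ^ 2`; then turns around that closed walk can be added, or exchanged for other closed
walks of total length divisible by `l`. -/
theorem exists_walk_period {A : Finset V} {N G : ℕ} (hA : ∀ u v b, E u v b → u ∈ A)
    (hb : ∀ u v b, E u v b → b ≤ 1) (hN : A.card ≤ N) (g : V → ℕ) (hg : ∀ u, g u ≤ G)
    (W : ℕ → ℕ)
    (hW : ∀ T, 0 < T → IsGreatest {m | ∃ u v c, Walk E T u v c ∧ m = g u + c} (W T)) :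
    ∃ q : ℝ, ∀ T, N ^ 2 * (G + 2 * N + 1) < T →
      (W (T + N.factorial) : ℝ) = W T + q * N.factorial := by
  -- A closed walk of length at most `N` and of the largest mean weight.
  obtain ⟨⟨l₀, c₀⟩, ⟨hl₀, hl₀N, x₀, hx₀⟩, hmax⟩ : ∃ p ∈ {p : ℕ × ℕ | 0 < p.1 ∧ p.1 ≤ N ∧
      ∃ x, Walk E p.1 x x p.2}, ∀ r ∈ {p : ℕ × ℕ | 0 < p.1 ∧ p.1 ≤ N ∧
      ∃ x, Walk E p.1 x x p.2}, (r.2 : ℝ) / r.1 ≤ (p.2 : ℝ) / p.1 := by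
    refine Set.exists_max_image _ (fun p : ℕ × ℕ => (p.2 : ℝ) / p.1) ?_ ?_
    · refine ((Set.finite_Iic N).prod (Set.finite_Iic N)).subset ?_
      rintro ⟨l, c⟩ ⟨-, hl, x, hx⟩
      exact ⟨hl, (hx.le_length hb).trans hl⟩
    · obtain ⟨u, v, c, h, -⟩ := (hW (N + 1) (by omega)).1
      obtain ⟨y, a, k, b, c₁, c₂, c₃, hk, hkN, -, -, -, h₂, -⟩ :=
        h.exists_closed hA hN one_pos (by omega)
      exact ⟨(k, c₂), hk, hkN, y, by simpa using h₂⟩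
  dsimp only at hl₀ hl₀N hx₀ hmax
  have hl₀' : (0 : ℝ) < l₀ := by exact_mod_cast hl₀
  have hNpos : 0 < N := by omega
  have hN' : (0 : ℝ) < N := by exact_mod_cast hNpos
  have hN1 : (1 : ℝ) ≤ N := by exact_mod_cast hNpos
  obtain ⟨q, hqdef⟩ : ∃ q : ℝ, q = (c₀ : ℝ) / l₀ := ⟨_, rfl⟩
  have hc₀ : (c₀ : ℝ) = q * l₀ := by rw [hqdef]; field_simp
  have hq0 : 0 ≤ q := by rw [hqdef]; positivity
  have hq1 : q ≤ 1 := by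
    rw [hqdef, div_le_one hl₀']
    exact_mod_cast hx₀.le_length hb
  have hqs : ∀ l x c, 0 < l → l ≤ N → Walk E l x x c → (c : ℝ) ≤ q * l := by
    intro l x c hl hlN h
    have hl' : (0 : ℝ) < l := by exact_mod_cast hl
    rw [← div_le_iff₀ hl', hqdef]
    exact hmax (l, c) ⟨hl, hlN, x, h⟩
  have hqa : ∀ l x c, Walk E l x x c → (c : ℝ) ≤ q * l := fun l x c h => h.closed_le hA hN hqs
  -- A lower bound for `W`: run around the critical closed walk.
  have hlow : ∀ T, 0 < T → q * T - N ≤ W T := by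
    intro T hT
    obtain ⟨v, d₁, d₂, hv, -, hd⟩ := Walk.split (a := T % l₀) (b := l₀ - T % l₀) (c := c₀)
      (u := x₀) (w := x₀) (E := E) (by
        have := (Nat.mod_lt T hl₀).le
        rwa [Nat.add_sub_cancel' this])
    have h := (hx₀.iterate (T / l₀)).append hv
    rw [mul_comm, Nat.div_add_mod] at h
    have h1 := (hW T hT).2 ⟨_, _, _, h, rfl⟩
    have h2 : T / l₀ * c₀ ≤ W T := by omega
    have h3 : ((T / l₀ : ℕ) : ℝ) * c₀ ≤ W T := by exact_mod_cast h2
    have h4 : T ≤ l₀ * (T / l₀) + N := by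
      have := Nat.div_add_mod T l₀
      have := Nat.mod_lt T hl₀
      omega
    have h5 : (T : ℝ) ≤ l₀ * (T / l₀ : ℕ) + N := by exact_mod_cast h4
    rw [hc₀] at h3
    nlinarith
  -- An optimal walk meets a critical closed walk.
  let Z : Set V := {x | ∃ l c, 0 < l ∧ l ≤ N ∧ Walk E l x x c ∧ (c : ℝ) = q * l}
  have hhit : ∀ T, N ^ 2 * (G + 2 * N + 1) < T → ∃ u w c, Walk E T u w c ∧ W T = g u + c ∧
      ∃ x ∈ Z, ∃ a b c₁ c₂, T = a + b ∧ c = c₁ + c₂ ∧ Walk E a u x c₁ ∧ Walk E b x w c₂ := by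
    intro T hT
    obtain ⟨u, w, c, h, hc⟩ := (hW T (by omega)).1
    refine ⟨u, w, c, h, hc, (h.avoid_or_hit Z).resolve_left fun h' => ?_⟩
    have h1 := h'.le_add (A := A) (N := N) (q := q - 1 / (N : ℝ) ^ 2)
      (fun u v b h => hA _ _ _ h.1) (fun u v b h => hb _ _ _ h.1) hN (by
        have : (1 : ℝ) / (N : ℝ) ^ 2 * N ≤ 1 := by
          rw [div_mul_eq_mul_div, div_le_one (by positivity)]
          nlinarith
        nlinarith [mul_nonneg hq0 hN'.le]) (by
        intro l x c hl hlN hx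
        have hxE := Walk.mono (E' := E) (fun _ _ _ h => h.1) hx
        have hxZ : x ∉ Z := by
          obtain ⟨l, rfl⟩ : ∃ k, l = 1 + k := ⟨l - 1, by omega⟩
          obtain ⟨v, e₁, e₂, ⟨v', _, _, ⟨rfl, _⟩, hv, _⟩, _, _⟩ := hx.split
          exact hv.2
        have hlt : (c : ℝ) < q * l :=
          lt_of_le_of_ne (hqs l x c hl hlN hxE) fun he => hxZ ⟨l, c, hl, hlN, hxE, he⟩
        have hl' : (0 : ℝ) < l := by exact_mod_cast hl
        have hlN' : (l : ℝ) ≤ N := by exact_mod_cast hlN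
        have hl₀N' : (l₀ : ℝ) ≤ N := by exact_mod_cast hl₀N
        -- Cross multiplication gives an inequality of integers.
        have hint : c * l₀ + 1 ≤ c₀ * l := by
          have : (c : ℝ) * l₀ < c₀ * l := by rw [hc₀]; nlinarith
          exact_mod_cast this
        have hint' : (c : ℝ) * l₀ + 1 ≤ q * l₀ * l := by rw [← hc₀]; exact_mod_cast hint
        have hgap : 1 / (N : ℝ) ^ 2 * l * l₀ ≤ 1 := by
          rw [div_mul_eq_mul_div, div_mul_eq_mul_div, div_le_one (by positivity)]
          nlinarith
        have : (c : ℝ) * l₀ ≤ (q - 1 / (N : ℝ) ^ 2) * l * l₀ := by nlinarith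
        exact le_of_mul_le_mul_right this hl₀')
    have h2 := hlow T (by omega)
    have h3 : (g u : ℝ) ≤ G := by exact_mod_cast hg u
    have h4 : (W T : ℝ) = g u + c := by exact_mod_cast hc
    have h5 : (N : ℝ) ^ 2 * (G + 2 * N + 1) < T := by exact_mod_cast hT
    have h6 : (T : ℝ) / (N : ℝ) ^ 2 ≤ G + 2 * N + 1 := by
      have : (T : ℝ) / (N : ℝ) ^ 2 = 1 / (N : ℝ) ^ 2 * T := by ring
      rw [this]
      linarith
    rw [div_le_iff₀ (by positivity)] at h6
    linarith
  refine ⟨q, fun T hT => le_antisymm ?_ ?_⟩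
  · -- Exchange closed walks for turns around the critical one.
    obtain ⟨u, w, c, -, hWc, x, ⟨l, d, hl, hlN, hx, hd⟩, a, b, c₁, c₂, hab, rfl, h₁, h₂⟩ :=
      hhit (T + N.factorial) (by omega)
    obtain ⟨a', c₁', h₁', ha', ⟨k₁, hk₁⟩, e₁⟩ := h₁.reduce hA hN hqa hl
    obtain ⟨b', c₂', h₂', hb', ⟨k₂, hk₂⟩, e₂⟩ := h₂.reduce hA hN hqa hl
    obtain ⟨f, hf⟩ := Nat.dvd_factorial hl hlN
    have hle : a' + b' ≤ T := by
      have : N * l ≤ N * N := Nat.mul_le_mul_left _ hlN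
      have : N ^ 2 * (G + 2 * N + 1) = N * N + N * N + N ^ 2 * (G + 2 * (N - 1) + 1) := by
        obtain ⟨m, rfl⟩ : ∃ m, N = m + 1 := ⟨N - 1, by omega⟩
        simp only [Nat.add_sub_cancel]
        ring
      omega
    have hfk : f ≤ k₁ + k₂ := by
      refine Nat.le_of_mul_le_mul_right (c := l) ?_ hl
      rw [Nat.add_mul, mul_comm f]
      omega
    obtain ⟨k, hk⟩ := Nat.exists_eq_add_of_le hfk
    have hTk : T = a' + k * l + b' := by
      have : (k₁ + k₂) * l = l * f + k * l := by rw [hk]; ring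
      rw [Nat.add_mul] at this
      omega
    have hwalk := (h₁'.append (hx.iterate k)).append h₂'
    rw [← hTk] at hwalk
    have h3 := (hW T (by omega)).2 ⟨_, _, _, hwalk, rfl⟩
    have h3' : (g u : ℝ) + (c₁' + k * d + c₂') ≤ W T := by exact_mod_cast h3
    have h4 : (W (T + N.factorial) : ℝ) = g u + (c₁ + c₂) := by exact_mod_cast hWc
    have h5 : (T : ℝ) + N.factorial = a + b := by exact_mod_cast hab
    have h6 : (T : ℝ) = a' + k * l + b' := by exact_mod_cast hTk
    have h7 : q * T + q * N.factorial = q * a + q * b := by rw [← mul_add, h5, mul_add]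
    have h8 : q * T = q * a' + k * (q * l) + q * b' := by rw [h6]; ring
    rw [hd] at h3'
    linarith
  · -- Insert turns around the critical closed walk.
    obtain ⟨u, w, c, -, hWc, x, ⟨l, d, hl, hlN, hx, hd⟩, a, b, c₁, c₂, rfl, rfl, h₁, h₂⟩ :=
      hhit T hT
    obtain ⟨f, hf⟩ := Nat.dvd_factorial hl hlN
    have hwalk := (h₁.append (hx.iterate f)).append h₂
    have h3 := (hW (a + b + N.factorial) (by omega)).2
      ⟨u, w, _, by rwa [show a + b + N.factorial = a + f * l + b by rw [hf]; ring], rfl⟩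
    have h3' : (g u : ℝ) + (c₁ + f * d + c₂) ≤ W (a + b + N.factorial) := by exact_mod_cast h3
    have h4 : (W (a + b) : ℝ) = g u + (c₁ + c₂) := by exact_mod_cast hWc
    have h5 : (N.factorial : ℝ) = l * f := by exact_mod_cast hf
    rw [hd] at h3'
    rw [h4, h5]
    linarith

end Walk

/-! ### Regions of windows -/

/-- The window of length `n + 1` of `y` that starts at position `j` satisfies `a`. -/
def WindowSol {n : ℕ} (a : Fin (n + 1) → ℤ) (y : ℕ → ℝ) (j : ℕ) : Prop :=
  MinAttainedTwice (fun i : Fin (n + 1) => y (j + i) + (a i : ℝ))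

/-- The region of the window `y k, …, y (k + m - 1)`: the integer parts of all differences of its
entries. It determines how these differences compare with integers. -/
noncomputable def region (m : ℕ) (y : ℕ → ℝ) (k : ℕ) : Fin m → Fin m → ℤ :=
  fun i j => ⌊y (k + j) - y (k + i)⌋

/-- The entry `y k` is fresh if it differs by a non-integer from each of the `n` entries before
it (of all entries before it if `k < n`). -/
def Fresh (n : ℕ) (y : ℕ → ℝ) (k : ℕ) : Prop :=
  ∀ i, i < k → k ≤ i + n → ¬ ∃ z : ℤ, y k - y i = z

/-- The step from `y i` to `y (i + 1)` is smaller than `M + 1` in absolute value. -/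
def SmallStep (M : ℕ) (y : ℕ → ℝ) (i : ℕ) : Prop :=
  ⌊y (i + 1) - y i⌋ ≤ (M : ℤ) ∧ ⌊y i - y (i + 1)⌋ ≤ (M : ℤ)

open Classical in
/-- The number of fresh entries among `y 0, …, y (s - 1)`. -/
noncomputable def freshCount (n s : ℕ) (y : ℕ → ℝ) : ℕ :=
  ∑ k ∈ Finset.range s, if Fresh n y k then 1 else 0

open Classical in
/-- The number of fresh entries of an initial window, read off its region. -/
noncomputable def regionFresh {n : ℕ} (R : Fin n → Fin n → ℤ) : ℕ :=
  ∑ k, if ∀ i, i < k → R k i + R i k ≠ 0 then 1 else 0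

open Classical in
/-- The transition graph: the edges join the regions of the first and of the last `n` entries of
windows of length `n + 1` that satisfy `a` and have small steps; the weight tells whether the last
entry is fresh. -/
def Transition {n : ℕ} (M : ℕ) (a : Fin (n + 1) → ℤ) (R R' : Fin n → Fin n → ℤ) (b : ℕ) : Prop :=
  ∃ v : ℕ → ℝ, WindowSol a v 0 ∧ (∀ i, i < n → SmallStep M v i) ∧ R = region n v 0 ∧
    R' = region n v 1 ∧ b = if Fresh n v n then 1 else 0

theorem exists_int_sub_eq_iff (x y : ℝ) : (∃ z : ℤ, x - y = z) ↔ ⌊x - y⌋ + ⌊y - x⌋ = 0 := by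
  constructor
  · rintro ⟨z, hz⟩
    rw [← neg_sub x y, hz, Int.floor_intCast, ← Int.cast_neg, Int.floor_intCast]
    omega
  · intro h
    refine ⟨⌊x - y⌋, le_antisymm ?_ (Int.floor_le _)⟩
    have h1 := Int.floor_le (y - x)
    have h2 : (⌊x - y⌋ : ℝ) + ⌊y - x⌋ = 0 := by exact_mod_cast h
    linarith

theorem regionFresh_region (n : ℕ) (y : ℕ → ℝ) : regionFresh (region n y 0) = freshCount n n y := by
  classical
  rw [regionFresh, freshCount, Finset.sum_range]
  refine Finset.sum_congr rfl fun k _ => if_congr ?_ rfl rfl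
  simp only [Fresh, region, zero_add, exists_int_sub_eq_iff]
  refine ⟨fun h i hi _ => ?_, fun h i hi => ?_⟩
  · rw [add_comm]
    exact h ⟨i, by omega⟩ hi
  · rw [add_comm]
    exact h i hi (by omega)

theorem regionFresh_le {n : ℕ} (R : Fin n → Fin n → ℤ) : regionFresh R ≤ n := by
  classical
  refine (Finset.sum_le_card_nsmul _ _ 1 fun k _ => ?_).trans (by simp)
  split_ifs <;> simp

theorem freshCount_add {n T : ℕ} (y : ℕ → ℝ) [DecidablePred fun k => Fresh n y (k + n)] :
    freshCount n (T + n) y =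
      regionFresh (region n y 0) + ∑ k ∈ Finset.range T, if Fresh n y (k + n) then 1 else 0 := by
  rw [regionFresh_region, freshCount, freshCount, add_comm T, Finset.sum_range_add]
  congr 1
  refine Finset.sum_congr rfl fun k _ => ?_
  rw [add_comm n k]
  congr

section Congr

variable {n : ℕ} {y v : ℕ → ℝ} {k l : ℕ}

theorem floor_eq_of_region_eq {m : ℕ} (h : region m y k = region m v l) {i j : ℕ} (hi : i < m)
    (hj : j < m) : ⌊y (k + j) - y (k + i)⌋ = ⌊v (l + j) - v (l + i)⌋ :=
  congrFun (congrFun h ⟨i, hi⟩) ⟨j, hj⟩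

theorem WindowSol.of_region_eq {a : Fin (n + 1) → ℤ} (hv : WindowSol a v l)
    (h : region (n + 1) y k = region (n + 1) v l) : WindowSol a y k := by
  have key : ∀ i j : Fin (n + 1), v (l + i) + (a i : ℝ) ≤ v (l + j) + a j →
      y (k + i) + (a i : ℝ) ≤ y (k + j) + a j := by
    intro i j hij
    have h1 : a i - a j ≤ ⌊v (l + j) - v (l + i)⌋ := by
      rw [Int.le_floor]
      push_cast
      linarith
    rw [← floor_eq_of_region_eq h i.2 j.2, Int.le_floor] at h1
    push_cast at h1
    linarith
  obtain ⟨i₁, i₂, hne, h₁, h₂⟩ := hv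
  exact ⟨i₁, i₂, hne, fun i => key _ _ (h₁ i), fun i => key _ _ (h₂ i)⟩

theorem SmallStep.of_region_eq {M i : ℕ} (hv : SmallStep M v (l + i))
    (h : region (n + 1) y k = region (n + 1) v l) (hi : i < n) : SmallStep M y (k + i) := by
  have h1 := floor_eq_of_region_eq h (i := i) (j := i + 1) (by omega) (by omega)
  have h2 := floor_eq_of_region_eq h (i := i + 1) (j := i) (by omega) (by omega)
  rw [SmallStep, add_assoc] at hv ⊢
  rw [h1, h2]
  exact hv

theorem fresh_iff_of_region_eq (h : region (n + 1) y k = region (n + 1) v 0) :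
    Fresh n y (k + n) ↔ Fresh n v n := by
  simp only [Fresh, exists_int_sub_eq_iff]
  constructor
  · intro hy i hi _
    have h1 := floor_eq_of_region_eq h (i := i) (j := n) (by omega) (by omega)
    have h2 := floor_eq_of_region_eq h (i := n) (j := i) (by omega) (by omega)
    simp only [zero_add] at h1 h2
    rw [← h1, ← h2]
    exact hy (k + i) (by omega) (by omega)
  · intro hv i hi hin
    obtain ⟨i, rfl⟩ := Nat.exists_eq_add_of_le (show k ≤ i by omega)
    have h1 := floor_eq_of_region_eq h (i := i) (j := n) (by omega) (by omega)
    have h2 := floor_eq_of_region_eq h (i := n) (j := i) (by omega) (by omega)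
    simp only [zero_add] at h1 h2
    rw [h1, h2]
    exact hv i (by omega) (by omega)

theorem region_eq_of_succ (h : region (n + 1) y k = region (n + 1) v l) :
    region n y k = region n v l := by
  ext i j
  exact floor_eq_of_region_eq h (by omega) (by omega)

theorem region_succ_eq_of_succ (h : region (n + 1) y k = region (n + 1) v l) :
    region n y (k + 1) = region n v (l + 1) := by
  ext i j
  have := floor_eq_of_region_eq h (i := i + 1) (j := j + 1) (by omega) (by omega)
  simpa only [region, add_assoc, add_comm 1] using this

theorem fresh_congr (h : ∀ i, i ≤ k → y i = v i) : Fresh n y k ↔ Fresh n v k := by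
  refine forall_congr' fun i => forall_congr' fun hi => ?_
  rw [h k le_rfl, h i hi.le]

theorem region_congr {m : ℕ} (h : ∀ i, i < m → y (k + i) = v (k + i)) :
    region m y k = region m v k := by
  ext i j
  simp only [region]
  rw [h i i.2, h j j.2]

end Congr

/-- A point added to a family of reals can be matched in every family with the same region. -/
theorem exists_point_same_floors {ι : Type*} [Finite ι] (u v : ι → ℝ)
    (h : ∀ i j, ⌊u j - u i⌋ = ⌊v j - v i⌋) (x : ℝ) :
    ∃ x', ∀ i, ⌊x' - u i⌋ = ⌊x - v i⌋ ∧ ⌊u i - x'⌋ = ⌊v i - x⌋ := by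
  classical
  have := Fintype.ofFinite ι
  by_cases hx : ∃ i, ∃ z : ℤ, x - v i = z
  · obtain ⟨i, z, hz⟩ := hx
    obtain rfl : x = v i + z := by linarith
    refine ⟨u i + z, fun j => ⟨?_, ?_⟩⟩
    · rw [add_sub_right_comm, add_sub_right_comm, Int.floor_add_intCast, Int.floor_add_intCast, h]
    · rw [← sub_sub, ← sub_sub, Int.floor_sub_intCast, Int.floor_sub_intCast, h]
  push Not at hx
  obtain ⟨x', h1, h2⟩ := Order.exists_between_finsets
    (Finset.univ.image fun i => u i + ⌊x - v i⌋)
    (Finset.univ.image fun i => u i + ⌊x - v i⌋ + 1) (by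
      simp only [Finset.mem_image, Finset.mem_univ, true_and, forall_exists_index,
        forall_apply_eq_imp_iff]
      intro i j
      have e1 := Int.floor_le (x - v i)
      have e2 := Int.lt_floor_add_one (x - v j)
      have : ⌊v i - v j⌋ < ⌊x - v j⌋ + 1 - ⌊x - v i⌋ := by
        rw [Int.floor_lt]
        push_cast
        linarith
      rw [← h, Int.floor_lt] at this
      push_cast at this
      linarith)
  simp only [Finset.mem_image, Finset.mem_univ, true_and, forall_exists_index,
    forall_apply_eq_imp_iff] at h1 h2
  refine ⟨x', fun i => ⟨?_, ?_⟩⟩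
  · rw [Int.floor_eq_iff]
    constructor <;> linarith [h1 i, h2 i]
  · have e1 := lt_of_le_of_ne (Int.floor_le (x - v i)) (hx i _).symm
    have e2 := Int.lt_floor_add_one (x - v i)
    have : ⌊v i - x⌋ = -⌊x - v i⌋ - 1 := by
      rw [Int.floor_eq_iff]
      push_cast
      constructor <;> linarith
    rw [this, Int.floor_eq_iff]
    push_cast
    constructor <;> linarith [h1 i, h2 i]

section Transition

variable {n M : ℕ} {a : Fin (n + 1) → ℤ}

open Classical in
/-- Solutions with small steps run along walks in the transition graph. -/
theorem walk_of_solution {T : ℕ} {y : ℕ → ℝ} (hy : ∀ j, j < T → WindowSol a y j)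
    (hM : ∀ i, i + 1 < T + n → SmallStep M y i) :
    Walk (Transition M a) T (region n y 0) (region n y T)
      (∑ k ∈ Finset.range T, if Fresh n y (k + n) then 1 else 0) := by
  induction T with
  | zero => exact ⟨rfl, rfl⟩
  | succ T ih =>
    refine ⟨region n y T, _, _, ih (fun j hj => hy j (by omega)) (fun i hi => hM i (by omega)), ?_,
      Finset.sum_range_succ _ _⟩
    have h : region (n + 1) (fun i => y (T + i)) 0 = region (n + 1) y T := by
      ext i j
      simp [region]
    refine ⟨fun i => y (T + i), (hy T (by omega)).of_region_eq h, fun i hi => ?_,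
      (region_eq_of_succ h).symm, (region_succ_eq_of_succ h).symm,
      if_congr (fresh_iff_of_region_eq h.symm) rfl rfl⟩
    simpa using SmallStep.of_region_eq (hM (T + i) (by omega)) h hi

open Classical in
/-- Walks in the transition graph lift to solutions: each further entry is found by matching the
last entry of the window that realizes the edge. -/
theorem exists_solution_of_walk {T : ℕ} {R R' : Fin n → Fin n → ℤ} {c : ℕ}
    (h : Walk (Transition M a) T R R' c) (hR : ∃ v, R = region n v 0) :
    ∃ y : ℕ → ℝ, (∀ j, j < T → WindowSol a y j) ∧ R = region n y 0 ∧ R' = region n y T ∧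
      c = ∑ k ∈ Finset.range T, if Fresh n y (k + n) then 1 else 0 := by
  induction T generalizing R' c with
  | zero =>
    obtain ⟨v, rfl⟩ := hR
    exact ⟨v, by simp, rfl, h.1.symm, by simp [h.2]⟩
  | succ T ih =>
    obtain ⟨Q, d, b, hd, ⟨v, hv, -, hQ, rfl, rfl⟩, rfl⟩ := h
    obtain ⟨y, hy, hR0, hQ', rfl⟩ := ih hd
    have hreg : region n y T = region n v 0 := by rw [← hQ', hQ]
    obtain ⟨x, hx⟩ := exists_point_same_floors (fun i : Fin n => y (T + i)) (fun i : Fin n => v i)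
      (fun i j => by simpa using floor_eq_of_region_eq hreg i.2 j.2) (v n)
    obtain ⟨y', hy'⟩ : ∃ y', y' = Function.update y (T + n) x := ⟨_, rfl⟩
    have hlt : ∀ i, i < T + n → y' i = y i := fun i hi => by
      rw [hy', Function.update_of_ne hi.ne]
    have hx' : y' (T + n) = x := by rw [hy', Function.update_self]
    have h' : region (n + 1) y' T = region (n + 1) v 0 := by
      ext i j
      simp only [region, zero_add]
      rcases Nat.lt_succ_iff_lt_or_eq.1 i.2 with hi | hi <;>
        rcases Nat.lt_succ_iff_lt_or_eq.1 j.2 with hj | hj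
      · rw [hlt _ (by omega), hlt _ (by omega)]
        simpa using floor_eq_of_region_eq hreg hi hj
      · rw [hj, hx', hlt _ (by omega)]
        exact (hx ⟨i, hi⟩).1
      · rw [hi, hx', hlt _ (by omega)]
        exact (hx ⟨j, hj⟩).2
      · rw [hi, hj]
        simp
    refine ⟨y', fun j hj => ?_, ?_, (region_succ_eq_of_succ h').symm, ?_⟩
    · rcases Nat.lt_succ_iff_lt_or_eq.1 hj with hj | rfl
      · refine (hy j hj).of_region_eq (region_congr fun i hi => hlt _ (by omega))
      · exact hv.of_region_eq h'
    · rw [hR0]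
      exact region_congr fun i hi => (hlt _ (by omega)).symm
    · rw [Finset.sum_range_succ]
      congr 1
      · refine Finset.sum_congr rfl fun k hk => if_congr ?_ rfl rfl
        have := Finset.mem_range.1 hk
        exact fresh_congr fun i hi => (hlt i (by omega)).symm
      · exact if_congr (fresh_iff_of_region_eq h').symm rfl rfl

end Transition

theorem floor_sub_eq (x y : ℝ) :
    ⌊x - y⌋ = ⌊x⌋ - ⌊y⌋ + if Int.fract x < Int.fract y then -1 else 0 := by
  rw [Int.floor_eq_iff]
  have hx := Int.floor_add_fract x
  have hy := Int.floor_add_fract y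
  have hx0 := Int.fract_nonneg x
  have hy0 := Int.fract_nonneg y
  have hx1 := Int.fract_lt_one x
  have hy1 := Int.fract_lt_one y
  split_ifs with h
  · push_cast
    constructor <;> linarith
  · push_cast
    constructor <;> linarith

/-- The number of entries of a family with a smaller fractional part than the entry `i`. -/
noncomputable def fractRank {m : ℕ} (v : ℕ → ℝ) (i : Fin m) : Fin m :=
  ⟨(Finset.univ.filter fun k : Fin m => Int.fract (v k) < Int.fract (v i)).card, by
    refine lt_of_lt_of_eq (Finset.card_lt_card (Finset.filter_ssubset.2 ⟨i, ?_⟩)) (by simp)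
    simp⟩

theorem fractRank_lt_iff {m : ℕ} (v : ℕ → ℝ) (i j : Fin m) :
    fractRank v i < fractRank v j ↔ Int.fract (v i) < Int.fract (v j) := by
  constructor
  · intro h
    by_contra! hle
    refine absurd h (not_lt.2 (Fin.mk_le_mk.2 (Finset.card_le_card fun k hk => ?_)))
    simp only [Finset.mem_filter, Finset.mem_univ, true_and] at hk ⊢
    exact hk.trans_le hle
  · intro h
    refine Fin.mk_lt_mk.2 (Finset.card_lt_card ?_)
    rw [Finset.ssubset_iff_of_subset]
    · exact ⟨i, by simpa using h, by simp⟩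
    · intro k hk
      simp only [Finset.mem_filter, Finset.mem_univ, true_and] at hk ⊢
      exact hk.trans h

/-- The regions of the windows of length `m + 1` with small steps. -/
def smallRegions (M m : ℕ) : Set (Fin (m + 1) → Fin (m + 1) → ℤ) :=
  {R | ∃ v : ℕ → ℝ, (∀ i, i < m → SmallStep M v i) ∧ R = region (m + 1) v 0}

theorem SmallStep.floor_sub_le {M i : ℕ} {v : ℕ → ℝ} (h : SmallStep M v i) :
    |⌊v (i + 1)⌋ - ⌊v i⌋| ≤ (M : ℤ) + 1 := by
  obtain ⟨h1, h2⟩ := h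
  rw [floor_sub_eq] at h1 h2
  rw [abs_le]
  split_ifs at h1 h2 <;> constructor <;> omega

/-- The region of a window is determined by the steps of the integer parts and by the order of the
fractional parts of its entries. -/
theorem smallRegions_card (M m : ℕ) : (smallRegions M m).Finite ∧
    (smallRegions M m).ncard ≤ (2 * M + 3) ^ m * (m + 1) ^ (m + 1) := by
  have : NeZero (2 * M + 3) := ⟨by omega⟩
  choose! v hv hvR using fun R (hR : R ∈ smallRegions M m) => hR
  let code : (Fin (m + 1) → Fin (m + 1) → ℤ) →
      (Fin m → ZMod (2 * M + 3)) × (Fin (m + 1) → Fin (m + 1)) := fun R =>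
    (fun i => ((⌊v R (i + 1)⌋ - ⌊v R i⌋ : ℤ) : ZMod (2 * M + 3)), fun i => fractRank (v R) i)
  have hinj : Set.InjOn code (smallRegions M m) := by
    intro R hR R' hR' h
    obtain ⟨h1, h2⟩ := Prod.mk.inj h
    have hstep : ∀ i, i < m → ⌊v R (i + 1)⌋ - ⌊v R i⌋ = ⌊v R' (i + 1)⌋ - ⌊v R' i⌋ := by
      intro i hi
      have e := congrFun h1 ⟨i, hi⟩
      rw [ZMod.intCast_eq_intCast_iff_dvd_sub] at e
      have b1 := abs_le.1 (hv R hR i hi).floor_sub_le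
      have b2 := abs_le.1 (hv R' hR' i hi).floor_sub_le
      have := Int.eq_zero_of_abs_lt_dvd e (by
        rw [abs_lt]
        push_cast
        constructor <;> omega)
      dsimp only at this
      omega
    have hsum : ∀ i, i ≤ m → ⌊v R i⌋ - ⌊v R 0⌋ = ⌊v R' i⌋ - ⌊v R' 0⌋ := by
      intro i
      induction i with
      | zero => simp
      | succ i ih =>
        intro hi
        have := ih (by omega)
        have := hstep i hi
        omega
    rw [hvR R hR, hvR R' hR']
    ext i j
    simp only [region, zero_add]
    rw [floor_sub_eq, floor_sub_eq]
    have e1 := hsum i (by omega)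
    have e2 := hsum j (by omega)
    have e3 : Int.fract (v R j) < Int.fract (v R i) ↔
        Int.fract (v R' j) < Int.fract (v R' i) := by
      rw [← fractRank_lt_iff, ← fractRank_lt_iff, congrFun h2 i, congrFun h2 j]
    rw [if_congr e3 rfl rfl]
    omega
  have hfin : (smallRegions M m).Finite :=
    Set.Finite.of_finite_image (Set.toFinite _) hinj
  refine ⟨hfin, ?_⟩
  calc (smallRegions M m).ncard = (code '' smallRegions M m).ncard := (hinj.ncard_image).symm
    _ ≤ Nat.card ((Fin m → ZMod (2 * M + 3)) × (Fin (m + 1) → Fin (m + 1))) := by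
        rw [← Set.ncard_univ]
        exact Set.ncard_le_ncard (Set.subset_univ _) (Set.toFinite _)
    _ = _ := by simp

/-! ### The dimension as a number of fresh entries -/

theorem exists_solution {n : ℕ} (hn : 0 < n) (a : Fin (n + 1) → ℤ) (s : ℕ) :
    ∃ y : ℕ → ℝ, ∀ j, j + n < s → WindowSol a y j := by
  induction s with
  | zero => exact ⟨0, by simp⟩
  | succ s ih =>
    obtain ⟨y, hy⟩ := ih
    rcases lt_or_ge s n with hs | hs
    · exact ⟨y, fun j hj => by omega⟩
    obtain ⟨j₀, rfl⟩ := Nat.exists_eq_add_of_le' hs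
    have : Nonempty (Fin n) := ⟨⟨0, hn⟩⟩
    -- The new entry makes the last term of its window equal to the least of the other ones.
    obtain ⟨i₀, hi₀⟩ := Finite.exists_min (fun i : Fin n => y (j₀ + i) + (a i.castSucc : ℝ))
    have hlt : ∀ x i, i < j₀ + n → Function.update y (j₀ + n) x i = y i := fun x i hi =>
      Function.update_of_ne hi.ne _ _
    refine ⟨Function.update y (j₀ + n) (y (j₀ + i₀) + a i₀.castSucc - a (Fin.last n)),
      fun j hj => ?_⟩
    rcases Nat.lt_succ_iff_lt_or_eq.1 hj with hj | hj
    · exact (hy j hj).of_region_eq (region_congr fun i hi => hlt _ _ (by omega))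
    · obtain rfl : j = j₀ := by omega
      refine ⟨i₀.castSucc, Fin.last n, (Fin.castSucc_lt_last i₀).ne, ?_, ?_⟩ <;>
        intro i <;> induction i using Fin.lastCases with
        | last => simp [hlt]
        | cast i => simpa [hlt] using hi₀ i

theorem IsPolyhedron.convex {s : ℕ} {P : Set (Fin s → ℝ)} (hP : IsPolyhedron P) : Convex ℝ P := by
  obtain ⟨S, T, rfl⟩ := hP
  have hlin : ∀ c : Fin s → ℝ, IsLinearMap ℝ fun x : Fin s → ℝ => c ⬝ᵥ x := fun c =>
    ⟨dotProduct_add c, fun r x => dotProduct_smul r c x⟩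
  intro x hx y hy α β hα hβ hαβ
  exact ⟨fun p hp => convex_halfSpace_le (hlin p.1) p.2 (hx.1 p hp) (hy.1 p hp) hα hβ hαβ,
    fun p hp => convex_halfSpace_lt (hlin p.1) p.2 (hx.2 p hp) (hy.2 p hp) hα hβ hαβ⟩

/-- A nonempty convex set contains a point at which the difference of two coordinates is an
integer only if that difference is constant on the set. -/
theorem exists_generic_point {s : ℕ} {P : Set (Fin s → ℝ)} (hP : Convex ℝ P) (hne : P.Nonempty)
    (F : Finset (Fin s × Fin s)) :
    ∃ y ∈ P, ∀ p ∈ F, (∃ z : ℤ, y p.1 - y p.2 = z) →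
      ∀ w ∈ P, w p.1 - w p.2 = y p.1 - y p.2 := by
  classical
  induction F using Finset.induction_on with
  | empty =>
    obtain ⟨y, hy⟩ := hne
    exact ⟨y, hy, by simp⟩
  | insert p F _ ih =>
    obtain ⟨y, hy, hF⟩ := ih
    by_cases hp : ∀ w ∈ P, w p.1 - w p.2 = y p.1 - y p.2
    · refine ⟨y, hy, fun q hq => ?_⟩
      rcases Finset.mem_insert.1 hq with rfl | hq
      · exact fun _ => hp
      · exact hF q hq
    push Not at hp
    obtain ⟨w, hw, hne⟩ := hp
    let δ : Fin s × Fin s → ℝ := fun q => (w q.1 - w q.2) - (y q.1 - y q.2)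
    -- All but countably many points of the segment from `y` to `w` will do.
    let B : Set ℝ := ⋃ q ∈ {q : Fin s × Fin s | δ q ≠ 0},
      {t | ∃ z : ℤ, y q.1 - y q.2 + t * δ q = z}
    have hB : B.Countable := by
      refine (Set.to_countable _).biUnion fun q hq => ?_
      refine (Set.countable_range fun z : ℤ => ((z : ℝ) - (y q.1 - y q.2)) / δ q).mono ?_
      rintro t ⟨z, hz⟩
      refine ⟨z, ?_⟩
      have hq' : δ q ≠ 0 := hq
      rw [div_eq_iff hq', ← hz]
      ring
    obtain ⟨t, htB, ht0, ht1⟩ := (hB.dense_compl ℝ).exists_between (zero_lt_one (α := ℝ))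
    have hval : ∀ q : Fin s × Fin s, ((1 - t) • y + t • w) q.1 - ((1 - t) • y + t • w) q.2 =
        y q.1 - y q.2 + t * δ q := by
      intro q
      simp only [Pi.add_apply, Pi.smul_apply, smul_eq_mul, δ]
      ring
    refine ⟨(1 - t) • y + t • w, hP hy hw (by linarith) ht0.le (by ring), fun q hq hz => ?_⟩
    rw [hval] at hz ⊢
    by_cases hδ : δ q = 0
    · rw [hδ, mul_zero, add_zero] at hz ⊢
      rcases Finset.mem_insert.1 hq with rfl | hq
      · exact absurd (sub_eq_zero.1 hδ) hne
      · exact hF q hq hz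
    · exact absurd (Set.mem_biUnion (show q ∈ {q | δ q ≠ 0} from hδ) hz) htB

theorem freshCount_eq_card (n s : ℕ) (y : ℕ → ℝ) [Fintype {k : Fin s // Fresh n y k}] :
    freshCount n s y = Fintype.card {k : Fin s // Fresh n y k} := by
  classical
  rw [freshCount, Finset.sum_range, Fintype.card_subtype, Finset.card_filter]

/-- A direction of a polyhedron is determined by its coordinates at the fresh positions of a
generic point. -/
theorem exists_finrank_le_freshCount {n s : ℕ} {P : Set (Fin s → ℝ)} (hP : Convex ℝ P)
    (hne : P.Nonempty) : ∃ y : ℕ → ℝ, (fun k : Fin s => y k) ∈ P ∧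
      Module.finrank ℝ (vectorSpan ℝ P) ≤ freshCount n s y := by
  classical
  obtain ⟨y₀, hy₀, hgen⟩ := exists_generic_point hP hne Finset.univ
  obtain ⟨y, hy⟩ : ∃ y : ℕ → ℝ, ∀ k : Fin s, y k = y₀ k :=
    ⟨fun k => if h : k < s then y₀ ⟨k, h⟩ else 0, fun k => by simp⟩
  refine ⟨y, by simpa only [hy] using hy₀, ?_⟩
  have hV : ∀ u ∈ vectorSpan ℝ P, ∀ i k : Fin s, (∃ z : ℤ, y k - y i = z) → u k = u i := by
    intro u hu i k hz
    rw [hy, hy] at hz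
    have hle : vectorSpan ℝ P ≤ LinearMap.ker
        ((LinearMap.proj k : (Fin s → ℝ) →ₗ[ℝ] ℝ) - LinearMap.proj i) := by
      rw [vectorSpan_def, Submodule.span_le]
      rintro _ ⟨w, hw, w', hw', rfl⟩
      have e1 := hgen (k, i) (Finset.mem_univ _) hz w hw
      have e2 := hgen (k, i) (Finset.mem_univ _) hz w' hw'
      simp only [SetLike.mem_coe, LinearMap.mem_ker, LinearMap.sub_apply, LinearMap.proj_apply,
        vsub_eq_sub, Pi.sub_apply]
      dsimp only at e1 e2
      linarith
    have := hle hu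
    rw [LinearMap.mem_ker, LinearMap.sub_apply, LinearMap.proj_apply, LinearMap.proj_apply] at this
    linarith
  let Φ : vectorSpan ℝ P →ₗ[ℝ] ({k : Fin s // Fresh n y k} → ℝ) :=
    (LinearMap.funLeft ℝ ℝ fun k : {k : Fin s // Fresh n y k} => k.1).comp
      (vectorSpan ℝ P).subtype
  have hΦ : Function.Injective Φ := by
    rw [injective_iff_map_eq_zero]
    rintro ⟨u, hu⟩ h0
    have key : ∀ k (hk : k < s), u ⟨k, hk⟩ = 0 := by
      intro k
      induction k using Nat.strong_induction_on with
      | _ k ih =>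
        intro hk
        by_cases hf : Fresh n y k
        · exact congrFun h0 ⟨⟨k, hk⟩, hf⟩
        · simp only [Fresh, not_forall, not_not] at hf
          obtain ⟨i, hi, -, hz⟩ := hf
          rw [hV u hu ⟨i, by omega⟩ ⟨k, hk⟩ hz, ih i hi]
    ext k
    exact key k k.2
  calc Module.finrank ℝ (vectorSpan ℝ P)
      ≤ Module.finrank ℝ ({k : Fin s // Fresh n y k} → ℝ) :=
        LinearMap.finrank_le_finrank_of_injective hΦ
    _ = freshCount n s y := by rw [Module.finrank_fintype_fun_eq_card, freshCount_eq_card]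

/-- The vectors that agree at nearby positions where the entries of `y` differ by an integer form
a space of dimension at least the number of fresh positions: one equation for each other
position, relating it to the last position before it of this kind, is enough. -/
theorem freshCount_le_finrank {n s : ℕ} (y : ℕ → ℝ) (L : Submodule ℝ (Fin s → ℝ))
    (hL : ∀ u : Fin s → ℝ, (∀ i k : Fin s, i < k → (k : ℕ) ≤ i + n → (∃ z : ℤ, y k - y i = z) →
      u k = u i) → u ∈ L) : freshCount n s y ≤ Module.finrank ℝ L := by
  classical
  have hpred : ∀ k : {k : Fin s // ¬ Fresh n y k}, ∃ i : Fin s, i < k.1 ∧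
      (∃ z : ℤ, y k.1 - y i = z) ∧ ∀ j : Fin s, j < k.1 → (∃ z : ℤ, y k.1 - y j = z) → j ≤ i := by
    rintro ⟨k, hk⟩
    simp only [Fresh, not_forall, not_not] at hk
    obtain ⟨i, hi, -, hz⟩ := hk
    obtain ⟨m, hm, hmax⟩ := Set.exists_max_image
      {j : Fin s | j < k ∧ ∃ z : ℤ, y k - y j = z} id (Set.toFinite _)
      ⟨⟨i, by omega⟩, hi, hz⟩
    exact ⟨m, hm.1, hm.2, fun j hj hz => hmax j ⟨hj, hz⟩⟩
  choose pred hlt hint hmax using hpred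
  let Φ : (Fin s → ℝ) →ₗ[ℝ] ({k : Fin s // ¬ Fresh n y k} → ℝ) :=
    LinearMap.pi fun k =>
      (LinearMap.proj k.1 : (Fin s → ℝ) →ₗ[ℝ] ℝ) - LinearMap.proj (pred k)
  have hker : LinearMap.ker Φ ≤ L := by
    intro u hu
    have hu' : ∀ k, u k.1 = u (pred k) := fun k => sub_eq_zero.1 (congrFun hu k)
    refine hL u fun i k => ?_
    induction k using WellFoundedLT.induction with
    | _ k ih =>
      intro hik hkn hz
      have hk : ¬ Fresh n y k := fun h => h i hik hkn hz
      have h1 : i ≤ pred ⟨k, hk⟩ := hmax ⟨k, hk⟩ i hik hz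
      rw [hu' ⟨k, hk⟩]
      rcases h1.eq_or_lt with h1 | h1
      · rw [← h1]
      · have h2 : pred ⟨k, hk⟩ < k := hlt ⟨k, hk⟩
        refine ih _ h2 h1 (by have := Fin.lt_def.1 h2; omega) ?_
        obtain ⟨z, hz⟩ := hz
        obtain ⟨z', hz'⟩ := hint ⟨k, hk⟩
        refine ⟨z - z', ?_⟩
        push_cast
        dsimp only at hz'
        linarith
  have h1 := LinearMap.finrank_range_add_finrank_ker Φ
  have h2 : Module.finrank ℝ (LinearMap.range Φ) ≤ Fintype.card {k : Fin s // ¬ Fresh n y k} := by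
    refine (Submodule.finrank_le _).trans ?_
    rw [Module.finrank_fintype_fun_eq_card]
  have h3 := Submodule.finrank_mono hker
  rw [Module.finrank_fintype_fun_eq_card, Fintype.card_fin] at h1
  have h4 := Fintype.card_subtype_compl (fun k : Fin s => Fresh n y k)
  have h5 := Fintype.card_subtype_le (fun k : Fin s => Fresh n y k)
  rw [Fintype.card_fin] at h4 h5
  rw [freshCount_eq_card]
  omega

/-- Through each solution there is a polyhedron of solutions of dimension at least its number of
fresh entries, namely the cell of the solutions with prescribed positions of minima. -/
theorem exists_polyhedron {n s : ℕ} {a : Fin (n + 1) → ℤ} {y : ℕ → ℝ}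
    (hy : ∀ j, j + n < s → WindowSol a y j) : ∃ P : Set (Fin s → ℝ), IsPolyhedron P ∧
      P ⊆ solutions a s ∧ freshCount n s y ≤ Module.finrank ℝ (vectorSpan ℝ P) := by
  classical
  let J := {j : Fin s // (j : ℕ) + n < s}
  let pos : J → Fin (n + 1) → Fin s := fun j i => ⟨j.1 + i, by have := j.2; omega⟩
  have hκ : ∀ j : J, ∃ κ : Bool → Fin (n + 1), κ true ≠ κ false ∧ ∀ b i,
      y (pos j (κ b)) + (a (κ b) : ℝ) ≤ y (pos j i) + a i := by
    intro j
    obtain ⟨i₁, i₂, hne, h₁, h₂⟩ := hy j.1 j.2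
    refine ⟨fun b => if b then i₁ else i₂, by simpa using hne, fun b => ?_⟩
    cases b
    · simpa using h₂
    · simpa using h₁
  choose κ hne hmin using hκ
  let P : Set (Fin s → ℝ) := {z | ∀ p : J × Bool × Fin (n + 1),
    z (pos p.1 (κ p.1 p.2.1)) + (a (κ p.1 p.2.1) : ℝ) ≤ z (pos p.1 p.2.2) + a p.2.2}
  have hyP : (fun k : Fin s => y k) ∈ P := fun p => hmin p.1 p.2.1 p.2.2
  refine ⟨P, ?_, ?_, freshCount_le_finrank y _ ?_⟩
  · refine ⟨Finset.univ.image fun p : J × Bool × Fin (n + 1) =>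
      (Pi.single (pos p.1 (κ p.1 p.2.1)) 1 - Pi.single (pos p.1 p.2.2) 1,
        (a p.2.2 : ℝ) - a (κ p.1 p.2.1)), ∅, ?_⟩
    ext z
    simp only [P, Set.mem_ofPred_eq, Finset.mem_image, Finset.mem_univ, true_and,
      forall_exists_index, forall_apply_eq_imp_iff, sub_dotProduct, single_dotProduct, one_mul,
      Finset.notMem_empty, false_imp_iff, implies_true, and_true]
    refine forall_congr' fun p => ?_
    constructor <;> intro h <;> linarith
  · intro z hz j hj
    let j' : J := ⟨⟨j, by omega⟩, hj⟩
    exact ⟨κ j' true, κ j' false, hne j', fun i => hz (j', true, i), fun i => hz (j', false, i)⟩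
  · intro u hu
    -- Small multiples of `u` can be added to `y` within the cell.
    have hev : ∀ᶠ ε : ℝ in 𝓝[>] 0, (fun k : Fin s => y k) + ε • u ∈ P := by
      simp only [P, Set.mem_ofPred_eq]
      rw [eventually_all]
      rintro ⟨j, b, i⟩
      simp only [Pi.add_apply, Pi.smul_apply, smul_eq_mul]
      rcases (hmin j b i).eq_or_lt with h | h
      · have hui : u (pos j (κ j b)) = u (pos j i) := by
          rcases lt_trichotomy (pos j i) (pos j (κ j b)) with hlt | heq | hlt
          · refine hu _ _ hlt (by simp only [pos]; omega) ⟨a i - a (κ j b), ?_⟩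
            push_cast
            linarith
          · rw [heq]
          · refine (hu _ _ hlt (by simp only [pos]; omega) ⟨a (κ j b) - a i, ?_⟩).symm
            push_cast
            linarith
        refine Eventually.of_forall fun ε => ?_
        rw [hui]
        linarith
      · have hc : Tendsto (fun ε : ℝ => (y (pos j i) + ε * u (pos j i) + a i) -
            (y (pos j (κ j b)) + ε * u (pos j (κ j b)) + a (κ j b))) (𝓝[>] 0)
            (𝓝 ((y (pos j i) + 0 * u (pos j i) + a i) -
            (y (pos j (κ j b)) + 0 * u (pos j (κ j b)) + a (κ j b)))) :=
          (Continuous.tendsto (by fun_prop) 0).mono_left nhdsWithin_le_nhds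
        refine (hc.eventually (lt_mem_nhds (a := 0) (by linarith))).mono fun ε hε => ?_
        linarith
    obtain ⟨ε, hε, hεpos⟩ := (hev.and self_mem_nhdsWithin).exists
    have h1 := vsub_mem_vectorSpan ℝ hε hyP
    rw [vsub_eq_sub, add_sub_cancel_left] at h1
    exact (Submodule.smul_mem_iff _ (ne_of_gt hεpos)).1 h1

/-- The tropical Hilbert function is the largest number of fresh entries of a solution. -/
theorem tropicalHilbert_isGreatest {n : ℕ} (hn : 0 < n) (a : Fin (n + 1) → ℤ) (s : ℕ) :
    IsGreatest {m | ∃ y : ℕ → ℝ, (∀ j, j + n < s → WindowSol a y j) ∧ m = freshCount n s y}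
      (tropicalHilbert a s) := by
  have hgr := polyhedralDim_isGreatest (solutions a s)
  have hub : ∀ y : ℕ → ℝ, (∀ j, j + n < s → WindowSol a y j) →
      freshCount n s y ≤ tropicalHilbert a s := by
    intro y hy
    obtain ⟨P, hP, hPs, hle⟩ := exists_polyhedron hy
    exact hle.trans (hgr.2 ⟨P, hP, hPs, rfl⟩)
  refine ⟨?_, ?_⟩
  · obtain ⟨P, hP, hPs, hdim⟩ := hgr.1
    rcases P.eq_empty_or_nonempty with rfl | hne
    · obtain ⟨y, hy⟩ := exists_solution hn a s
      rw [vectorSpan_empty, finrank_bot] at hdim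
      exact ⟨y, hy, le_antisymm (hdim.le.trans (Nat.zero_le _)) (hub y hy)⟩
    · obtain ⟨y, hyP, hle⟩ := exists_finrank_le_freshCount (n := n) hP.convex hne
      have hy : ∀ j, j + n < s → WindowSol a y j := fun j hj => hPs hyP j hj
      exact ⟨y, hy, le_antisymm (hdim.le.trans hle) (hub y hy)⟩
  · rintro _ ⟨y, hy, rfl⟩
    exact hub y hy

/-! ### Reduction to solutions with small steps -/

/-- The minima `m j` of consecutive windows differ by at most `M`, and so do consecutive bounds
`U k`, the largest of the numbers `m j - a i` with `j + i = k`. The entries of a solution are at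
least `U k`; an entry that is not a minimum of any window may be lowered by an integer to a value
in `[U k, U k + 1)`. -/
theorem exists_smallStep_solution {n T M : ℕ} (hn : 0 < n) (hT : 0 < T) {a : Fin (n + 1) → ℤ}
    (ha : ∀ i j, a i - a j ≤ (M : ℤ)) {y : ℕ → ℝ} (hy : ∀ j, j < T → WindowSol a y j) :
    ∃ y' : ℕ → ℝ, (∀ j, j < T → WindowSol a y' j) ∧ (∀ i, i + 1 < T + n → SmallStep M y' i) ∧
      freshCount n (T + n) y' = freshCount n (T + n) y := by
  classical
  have ha' : ∀ i j, (a i : ℝ) - a j ≤ M := fun i j => by exact_mod_cast ha i j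
  have hm : ∀ j, ∃ m : ℝ, j < T → (∀ i : Fin (n + 1), m ≤ y (j + i) + a i) ∧
      ∃ i₁ i₂ : Fin (n + 1), i₁ ≠ i₂ ∧ y (j + i₁) + a i₁ = m ∧ y (j + i₂) + a i₂ = m := by
    intro j
    by_cases hj : j < T
    · obtain ⟨i₁, i₂, hne, h₁, h₂⟩ := hy j hj
      exact ⟨_, fun _ => ⟨h₁, i₁, i₂, hne, rfl, le_antisymm (h₂ i₁) (h₁ i₂)⟩⟩
    · exact ⟨0, fun h => absurd h hj⟩
  choose m hm using hm
  have hdown : ∀ j, j + 1 < T → m j - M ≤ m (j + 1) := by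
    intro j hj
    obtain ⟨i, hi, he⟩ : ∃ i : Fin (n + 1), (i : ℕ) < n ∧ y (j + 1 + i) + a i = m (j + 1) := by
      obtain ⟨i₁, i₂, hne, h₁, h₂⟩ := (hm (j + 1) hj).2
      by_cases h : (i₁ : ℕ) < n
      · exact ⟨i₁, h, h₁⟩
      · exact ⟨i₂, by omega, h₂⟩
    have h1 := (hm j (by omega)).1 ⟨i + 1, by omega⟩
    have h2 := ha' ⟨i + 1, by omega⟩ i
    dsimp only at h1
    rw [show j + ((i : ℕ) + 1) = j + 1 + i by omega] at h1
    linarith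
  have hup : ∀ j, j + 1 < T → m (j + 1) ≤ m j + M := by
    intro j hj
    obtain ⟨i, hi, he⟩ : ∃ i : Fin (n + 1), 0 < (i : ℕ) ∧ y (j + i) + a i = m j := by
      obtain ⟨i₁, i₂, hne, h₁, h₂⟩ := (hm j (by omega)).2
      by_cases h : 0 < (i₁ : ℕ)
      · exact ⟨i₁, h, h₁⟩
      · exact ⟨i₂, by omega, h₂⟩
    have h1 := (hm (j + 1) hj).1 ⟨i - 1, by omega⟩
    have h2 := ha' ⟨i - 1, by omega⟩ i
    dsimp only at h1
    rw [show j + 1 + ((i : ℕ) - 1) = j + i by omega] at h1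
    linarith
  have hU : ∀ k, ∃ U : ℝ, k < T + n →
      (∀ j (i : Fin (n + 1)), j < T → j + i = k → m j - a i ≤ U) ∧
      ∃ j, ∃ i : Fin (n + 1), j < T ∧ j + i = k ∧ U = m j - a i := by
    intro k
    by_cases hk : k < T + n
    · have hne : {p : Fin T × Fin (n + 1) | (p.1 : ℕ) + p.2 = k}.Nonempty := by
        by_cases hkT : k < T
        · exact ⟨(⟨k, hkT⟩, 0), by simp⟩
        · refine ⟨(⟨T - 1, by omega⟩, ⟨k - (T - 1), by omega⟩), ?_⟩
          change T - 1 + (k - (T - 1)) = k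
          omega
      obtain ⟨⟨j, i⟩, hji, hmax⟩ := Set.exists_max_image _
        (fun p : Fin T × Fin (n + 1) => m p.1 - a p.2) (Set.toFinite _) hne
      exact ⟨m j - a i, fun _ => ⟨fun j' i' hj' hk' => hmax (⟨j', hj'⟩, i') hk',
        j, i, j.2, hji, rfl⟩⟩
    · exact ⟨0, fun h => absurd h hk⟩
  choose U hU using hU
  have hUdown : ∀ k, k + 1 < T + n → U k - M ≤ U (k + 1) := by
    intro k hk
    obtain ⟨j, i, hj, hji, he⟩ := (hU k (by omega)).2
    by_cases hj' : j + 1 < T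
    · have h1 := (hU (k + 1) hk).1 (j + 1) i hj' (by omega)
      have h2 := hdown j hj'
      linarith
    · have h1 := (hU (k + 1) hk).1 j ⟨i + 1, by omega⟩ hj (by dsimp only; omega)
      have h2 := ha' ⟨i + 1, by omega⟩ i
      linarith
  have hUup : ∀ k, k + 1 < T + n → U (k + 1) ≤ U k + M := by
    intro k hk
    obtain ⟨j, i, hj, hji, he⟩ := (hU (k + 1) hk).2
    rcases j with _ | j
    · have h1 := (hU k (by omega)).1 0 ⟨i - 1, by omega⟩ hj (by dsimp only; omega)
      have h2 := ha' ⟨i - 1, by omega⟩ i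
      linarith
    · have h1 := (hU k (by omega)).1 j i (by omega) (by omega)
      have h2 := hup j hj
      linarith
  have hUy : ∀ k, k < T + n → U k ≤ y k := by
    intro k hk
    obtain ⟨j, i, hj, rfl, he⟩ := (hU k hk).2
    have := (hm j hj).1 i
    linarith
  obtain ⟨y', hy'⟩ : ∃ y' : ℕ → ℝ, ∀ k, y' k = y k - ⌊y k - U k⌋ :=
    ⟨fun k => y k - ⌊y k - U k⌋, fun k => rfl⟩
  have hge : ∀ k, U k ≤ y' k := fun k => by
    have := Int.floor_le (y k - U k)
    rw [hy']
    linarith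
  have hlt : ∀ k, y' k < U k + 1 := fun k => by
    have := Int.lt_floor_add_one (y k - U k)
    rw [hy']
    linarith
  refine ⟨y', fun j hj => ?_, fun i hi => ⟨?_, ?_⟩, ?_⟩
  · obtain ⟨i₁, i₂, hne, h₁, h₂⟩ := (hm j hj).2
    -- A minimum of a window is equal to its lower bound, so it has not been moved.
    have key : ∀ i : Fin (n + 1), y (j + i) + a i = m j → y' (j + i) + a i = m j := by
      intro i hi
      have e1 := (hU (j + i) (by omega)).1 j i hj rfl
      have e2 := hUy (j + i) (by omega)
      have e3 : y (j + i) - U (j + i) = 0 := by linarith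
      rw [hy', e3, Int.floor_zero, Int.cast_zero, sub_zero, hi]
    have hmin : ∀ i : Fin (n + 1), m j ≤ y' (j + i) + a i := by
      intro i
      have e1 := (hU (j + i) (by omega)).1 j i hj rfl
      have e2 := hge (j + i)
      linarith
    refine ⟨i₁, i₂, hne, fun i => ?_, fun i => ?_⟩
    · exact (key i₁ h₁).le.trans (hmin i)
    · exact (key i₂ h₂).le.trans (hmin i)
  · rw [← Int.lt_add_one_iff, Int.floor_lt]
    push_cast
    linarith [hlt (i + 1), hge i, hUup i hi]
  · rw [← Int.lt_add_one_iff, Int.floor_lt]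
    push_cast
    linarith [hlt i, hge (i + 1), hUdown i hi]
  · refine Finset.sum_congr rfl fun k _ => if_congr ?_ rfl rfl
    refine forall_congr' fun i => forall_congr' fun _ => forall_congr' fun _ => not_congr ?_
    rw [hy', hy']
    constructor
    · rintro ⟨z, hz⟩
      refine ⟨z + ⌊y k - U k⌋ - ⌊y i - U i⌋, ?_⟩
      push_cast
      linarith
    · rintro ⟨z, hz⟩
      refine ⟨z - ⌊y k - U k⌋ + ⌊y i - U i⌋, ?_⟩
      push_cast
      linarith

/-- The tropical Hilbert function is given by walks of maximal weight in the transition graph. -/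
theorem tropicalHilbert_isGreatest_walk {n T M : ℕ} (hn : 0 < n) (hT : 0 < T)
    {a : Fin (n + 1) → ℤ} (ha : ∀ i j, a i - a j ≤ (M : ℤ)) :
    IsGreatest {m | ∃ R R' c, Walk (Transition M a) T R R' c ∧ m = regionFresh R + c}
      (tropicalHilbert a (T + n)) := by
  classical
  obtain ⟨⟨y, hy, hmax⟩, hub⟩ := tropicalHilbert_isGreatest hn a (T + n)
  refine ⟨?_, ?_⟩
  · obtain ⟨y', hy', hM, hc⟩ := exists_smallStep_solution hn hT ha
      fun j (hj : j < T) => hy j (by omega)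
    exact ⟨_, _, _, walk_of_solution hy' hM, by rw [hmax, ← hc, freshCount_add]⟩
  · rintro _ ⟨R, R', c, h, rfl⟩
    have hR : ∃ v, R = region n v 0 := by
      obtain ⟨x, f, rfl, -, -, hE⟩ := h.exists_seq
      obtain ⟨v, -, -, hv, -⟩ := hE 0 hT
      exact ⟨v, hv⟩
    obtain ⟨z, hz, rfl, -, rfl⟩ := exists_solution_of_walk h hR
    rw [← freshCount_add]
    exact hub ⟨z, fun j hj => hz j (by omega), rfl⟩

/-! ### Periodicity and the constants -/

theorem exists_periodic_of_add_period {f : ℕ → ℝ} {p S : ℕ} (hp : 0 < p)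
    (hf : ∀ s, S < s → f (s + p) = f s) :
    ∃ r : ℕ → ℝ, Function.Periodic r p ∧ ∀ s, S < s → f s = r s := by
  have hk : ∀ k s, S < s → f (s + k * p) = f s := by
    intro k
    induction k with
    | zero => simp
    | succ k ih =>
      intro s hs
      rw [Nat.succ_mul, ← add_assoc, hf _ (by omega), ih s hs]
  refine ⟨fun s => f (s % p + (S + 1) * p), fun s => by simp, fun s hs => ?_⟩
  have h1 : S + 1 ≤ (S + 1) * p := Nat.le_mul_of_pos_right _ hp
  dsimp only
  rw [← hk (S + 1) s hs, ← hk (s / p) (s % p + (S + 1) * p) (by omega)]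
  congr 1
  have := Nat.mod_add_div' s p
  omega

theorem tendsto_div_of_eventually_linear {d r : ℕ → ℝ} {q : ℝ} {p S : ℕ} (hp : 0 < p)
    (hr : Function.Periodic r p) (hd : ∀ s, S < s → d s = q * s + r s) :
    Tendsto (fun s : ℕ => d s / s) atTop (𝓝 q) := by
  have hbound : ∀ s, |r s| ≤ ∑ i ∈ Finset.range p, |r i| := fun s => by
    rw [← hr.map_mod_nat s]
    exact Finset.single_le_sum (f := fun i => |r i|) (fun i _ => abs_nonneg _)
      (Finset.mem_range.2 (Nat.mod_lt s hp))
  have h0 : Tendsto (fun s : ℕ => r s / s) atTop (𝓝 0) := by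
    refine squeeze_zero_norm (fun s => ?_)
      (tendsto_const_div_atTop_nhds_zero_nat (∑ i ∈ Finset.range p, |r i|))
    rw [Real.norm_eq_abs, abs_div, Nat.abs_cast]
    exact div_le_div_of_nonneg_right (hbound s) (Nat.cast_nonneg s)
  have h1 : Tendsto (fun s : ℕ => q + r s / s) atTop (𝓝 q) := by
    simpa using tendsto_const_nhds.add h0
  refine h1.congr' ?_
  filter_upwards [eventually_gt_atTop S] with s hs
  have : (s : ℝ) ≠ 0 := Nat.cast_ne_zero.2 (by omega)
  rw [hd s hs]
  field_simp

/-- For `n = 1` consecutive entries of a solution differ by an integer. -/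
theorem tropicalHilbert_eq_one (a : Fin (1 + 1) → ℤ) {s : ℕ} (hs : 0 < s) :
    tropicalHilbert a s = 1 := by
  classical
  obtain ⟨y, hy, h⟩ := (tropicalHilbert_isGreatest one_pos a s).1
  obtain ⟨s, rfl⟩ : ∃ k, s = k + 1 := ⟨s - 1, by omega⟩
  rw [h, freshCount, Finset.sum_range_succ', Finset.sum_eq_zero, zero_add, if_pos]
  · exact fun i hi => absurd hi (Nat.not_lt_zero i)
  · intro k hk
    rw [Finset.mem_range] at hk
    refine if_neg fun hf => hf k (by omega) le_rfl ?_
    obtain ⟨i₁, i₂, hne, h₁, h₂⟩ := hy k (by omega)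
    have he : y (k + (0 : Fin 2)) + (a 0 : ℝ) = y (k + (1 : Fin 2)) + a 1 := by
      have h3 := le_antisymm (h₁ i₂) (h₂ i₁)
      fin_cases i₁ <;> fin_cases i₂
      · exact absurd rfl hne
      · exact h3
      · exact h3.symm
      · exact absurd rfl hne
    refine ⟨a 0 - a 1, ?_⟩
    simp only [Fin.val_zero, Fin.val_one, add_zero] at he
    push_cast
    linarith

theorem regions_bound_le {M m : ℕ} (hM : 1 ≤ M) :
    (2 * M + 3) ^ m * (m + 1) ^ (m + 1) ≤ (5 * M) ^ m * (m + 1) ^ (m + 1) :=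
  Nat.mul_le_mul_right _ (Nat.pow_le_pow_left (by omega) _)

theorem transient_le {M m N : ℕ} (hM : 1 ≤ M) (hm : 1 ≤ m)
    (hN : N = (2 * M + 3) ^ m * (m + 1) ^ (m + 1)) :
    N ^ 2 * ((m + 1) + 2 * N + 1) + (m + 1) ≤ (M * (m + 1)) ^ (14 * (m + 1)) := by
  obtain ⟨X, hX⟩ : ∃ X, X = (M * (m + 1)) ^ (m + 1) := ⟨_, rfl⟩
  have hb : m + 1 ≤ M * (m + 1) := Nat.le_mul_of_pos_left _ hM
  have hmX : m + 1 < X := by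
    rw [hX]
    exact lt_of_le_of_lt hb (Nat.lt_of_lt_of_le (Nat.lt_of_lt_of_le
      (by nlinarith : M * (m + 1) < (M * (m + 1)) ^ 2) le_rfl)
      (Nat.pow_le_pow_right (by omega) (by omega)))
  have hNX : N ≤ X ^ 4 := by
    calc N ≤ (5 * M) ^ m * (m + 1) ^ (m + 1) := hN ▸ regions_bound_le hM
      _ ≤ (5 * M) ^ (m + 1) * (m + 1) ^ (m + 1) :=
        Nat.mul_le_mul_right _ (Nat.pow_le_pow_right (by omega) (by omega))
      _ = (5 * (M * (m + 1))) ^ (m + 1) := by rw [← mul_pow, mul_assoc]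
      _ ≤ ((M * (m + 1)) ^ 4) ^ (m + 1) := by
        refine Nat.pow_le_pow_left ?_ _
        have h2 : 2 ^ 3 ≤ (M * (m + 1)) ^ 3 := Nat.pow_le_pow_left (by omega) _
        rw [pow_succ (M * (m + 1)) 3]
        exact Nat.mul_le_mul_right _ (by omega)
      _ = X ^ 4 := by rw [hX, ← pow_mul, ← pow_mul, mul_comm 4]
  have hX3 : 3 ≤ X := by omega
  have hX1 : 1 ≤ X ^ 4 := Nat.one_le_pow _ _ (by omega)
  have hXX : X ≤ X ^ 4 := Nat.le_self_pow (by norm_num) _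
  have hN2 : N ^ 2 ≤ X ^ 8 := by
    calc N ^ 2 ≤ (X ^ 4) ^ 2 := Nat.pow_le_pow_left hNX _
      _ = X ^ 8 := by ring
  have hX8 : X ≤ X ^ 8 := Nat.le_self_pow (by norm_num) _
  have hX12 : X ^ 8 ≤ X ^ 8 * X ^ 4 := Nat.le_mul_of_pos_right _ hX1
  calc N ^ 2 * ((m + 1) + 2 * N + 1) + (m + 1) ≤ X ^ 8 * (4 * X ^ 4) + X ^ 8 * X ^ 4 :=
        Nat.add_le_add (Nat.mul_le_mul hN2 (by omega)) (by omega)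
    _ = 5 * X ^ 12 := by ring
    _ ≤ X ^ 2 * X ^ 12 := Nat.mul_le_mul_right _ (by nlinarith)
    _ = (M * (m + 1)) ^ (14 * (m + 1)) := by rw [hX, ← pow_add, ← pow_mul, mul_comm (m + 1) (2 + 12)]

/-- The factor `M ^ m` in the number of regions, instead of `M ^ (m + 1)`, leaves room for the
logarithm in `N ! ≤ exp (N * log N)`. -/
theorem factorial_lt_exp {M m N : ℕ} (hM : 1 ≤ M)
    (hN : N = (2 * M + 3) ^ m * (m + 1) ^ (m + 1)) :
    (N.factorial : ℝ) < Real.exp (((20 : ℕ) * M * (m + 1 : ℕ) : ℝ) ^ (m + 1)) := by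
  have hNpos : (0 : ℝ) < N := by
    rw [hN]
    positivity
  have hM' : (1 : ℝ) ≤ M := by exact_mod_cast hM
  obtain ⟨B, hB⟩ : ∃ B : ℝ, B = 5 * M * (m + 1) := ⟨_, rfl⟩
  have hBpos : 0 < B := by
    rw [hB]
    positivity
  have hNle : (N : ℝ) ≤ (5 * M) ^ m * (m + 1) ^ (m + 1) := by
    exact_mod_cast hN ▸ regions_bound_le hM
  have hNB : (N : ℝ) ≤ B ^ (m + 1) := by
    refine hNle.trans ?_
    rw [hB, mul_pow (5 * (M : ℝ)) ((m : ℝ) + 1)]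
    gcongr
    · linarith
    · omega
  have hlog : Real.log N ≤ (m + 1) * B := by
    calc Real.log N ≤ Real.log (B ^ (m + 1)) := Real.log_le_log hNpos hNB
      _ = (m + 1) * Real.log B := by rw [Real.log_pow]; push_cast; ring
      _ ≤ (m + 1) * B := by
        gcongr
        linarith [Real.log_le_sub_one_of_pos hBpos]
  have hsq : ((m : ℝ) + 1) ^ 2 < 4 ^ (m + 1) := by
    have h1 : ((m : ℝ) + 1) < 2 ^ (m + 1) := by exact_mod_cast Nat.lt_two_pow_self
    calc ((m : ℝ) + 1) ^ 2 < (2 ^ (m + 1)) ^ 2 := by gcongr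
      _ = 4 ^ (m + 1) := by rw [← pow_mul, mul_comm, pow_mul]; norm_num
  calc (N.factorial : ℝ) ≤ (N : ℝ) ^ N := by exact_mod_cast Nat.factorial_le_pow N
    _ = Real.exp (N * Real.log N) := by rw [Real.exp_nat_mul, Real.exp_log hNpos]
    _ < _ := by
      rw [Real.exp_lt_exp]
      calc N * Real.log N ≤ (5 * M) ^ m * (m + 1) ^ (m + 1) * ((m + 1) * B) := by gcongr
        _ = B ^ (m + 1) * ((m : ℝ) + 1) ^ 2 := by
          rw [hB, mul_pow _ ((m : ℝ) + 1), pow_succ (5 * (M : ℝ))]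
          ring
        _ < B ^ (m + 1) * 4 ^ (m + 1) := by gcongr
        _ = _ := by
          rw [← mul_pow, hB]
          push_cast
          ring

theorem tropicalHilbert_add_period {M m N : ℕ} (a : Fin (m + 1 + 1) → ℤ)
    (ha : ∀ i j, a i - a j ≤ (M : ℤ)) (hN : N = (2 * M + 3) ^ m * (m + 1) ^ (m + 1)) :
    ∃ q : ℝ, ∀ s, N ^ 2 * ((m + 1) + 2 * N + 1) + (m + 1) < s →
      (tropicalHilbert a (s + N.factorial) : ℝ) = tropicalHilbert a s + q * N.factorial := by
  classical
  obtain ⟨hfin, hcard⟩ := smallRegions_card M m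
  obtain ⟨q, hq⟩ := exists_walk_period (E := Transition M a) (A := hfin.toFinset) (N := N)
    (G := m + 1)
    (by
      rintro _ _ _ ⟨v, -, hv, rfl, -, -⟩
      exact hfin.mem_toFinset.2 ⟨v, fun i hi => hv i (by omega), rfl⟩)
    (by
      rintro _ _ _ ⟨v, -, -, -, -, rfl⟩
      split_ifs <;> simp)
    (by rwa [← Set.ncard_eq_toFinset_card _ hfin, hN])
    regionFresh regionFresh_le (fun T => tropicalHilbert a (T + (m + 1)))
    (fun T hT => tropicalHilbert_isGreatest_walk (Nat.succ_pos m) hT ha)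
  refine ⟨q, fun s hs => ?_⟩
  obtain ⟨T, rfl⟩ : ∃ T, s = T + (m + 1) := ⟨s - (m + 1), by omega⟩
  rw [add_right_comm]
  exact hq T (by omega)

end TropicalHilbert

theorem corollary5p6 :
    ∃ C₁ C₂ : ℕ, ∀ (n M : ℕ), 1 ≤ n → 1 ≤ M →
      ∀ a : Fin (n + 1) → ℤ, (∀ i j, a i - a j ≤ (M : ℤ)) →
        Tendsto (fun s : ℕ => (TropicalHilbert.tropicalHilbert a s : ℝ) / (s : ℝ)) atTop
          (𝓝 (TropicalHilbert.tropicalEntropy a)) ∧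
        ∃ (r : ℕ → ℝ) (p : ℕ), 0 < p ∧
          (p : ℝ) < Real.exp (((C₂ : ℝ) * M * n) ^ n) ∧
          Function.Periodic r p ∧
          ∀ s : ℕ, (M * n) ^ (C₁ * n) < s →
            (TropicalHilbert.tropicalHilbert a s : ℝ) =
              TropicalHilbert.tropicalEntropy a * s + r s := by
  refine ⟨14, 20, fun n M hn hM a ha => ?_⟩
  -- The entropy is the slope of any eventual quasi-linear formula.
  suffices h : ∃ (q : ℝ) (r : ℕ → ℝ) (p : ℕ), 0 < p ∧
      (p : ℝ) < Real.exp ((((20 : ℕ) : ℝ) * M * n) ^ n) ∧ Function.Periodic r p ∧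
      ∀ s : ℕ, (M * n) ^ (14 * n) < s →
        (TropicalHilbert.tropicalHilbert a s : ℝ) = q * s + r s by
    obtain ⟨q, r, p, hp, hpe, hr, hs⟩ := h
    have ht := TropicalHilbert.tendsto_div_of_eventually_linear hp hr hs
    have hq : TropicalHilbert.tropicalEntropy a = q := ht.limUnder_eq
    rw [hq]
    exact ⟨ht, r, p, hp, hpe, hr, hs⟩
  obtain ⟨m, rfl⟩ : ∃ m, n = m + 1 := ⟨n - 1, by omega⟩
  rcases Nat.eq_zero_or_pos m with rfl | hm
  · refine ⟨0, fun _ => 1, 1, one_pos, ?_, fun _ => rfl, fun s hs => ?_⟩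
    · rw [Nat.cast_one, Real.one_lt_exp_iff]
      have : (1 : ℝ) ≤ M := by exact_mod_cast hM
      positivity
    · rw [TropicalHilbert.tropicalHilbert_eq_one a (by omega)]
      simp
  · obtain ⟨N, hN⟩ : ∃ N, N = (2 * M + 3) ^ m * (m + 1) ^ (m + 1) := ⟨_, rfl⟩
    obtain ⟨q, hq⟩ := TropicalHilbert.tropicalHilbert_add_period a ha hN
    have hle := TropicalHilbert.transient_le hM hm hN
    obtain ⟨r, hr, hrs⟩ := TropicalHilbert.exists_periodic_of_add_period
      (f := fun s => (TropicalHilbert.tropicalHilbert a s : ℝ) - q * s)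
      (S := (M * (m + 1)) ^ (14 * (m + 1))) N.factorial_pos (fun s hs => by
        rw [hq s (by omega)]
        push_cast
        ring)
    refine ⟨q, r, N.factorial, N.factorial_pos, TropicalHilbert.factorial_lt_exp hM hN, hr,
      fun s hs => ?_⟩
    rw [← hrs s hs]
    ring
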